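/- For $d \ge 1$ and $n \ge 0$ let $\mathcal H_n^d$ be the space of real polynomials $P$ on $\mathbb R^d$ that are homogeneous of degree $n$ and harmonic, i.e. $\Delta P = 0$ with $\Delta = \partial_1^2 + \cdots + \partial_d^2$ (the zero polynomial included). Let $SO(d)$ be the group of real orthogonal $d \times d$ matrices of determinant $1$, and let $T_{n,d}$ be the representation of $SO(d)$ on $\mathcal H_n^d$ given by $(T_{n,d}(Q) f)(x) = f(Q^{-1}x)$. (1) $T_{n,d}$ is irreducible: for all $d \ge 1$ and $n \ge 0$, the only linear subspaces of $\mathcal H_n^d$ that are invariant under $T_{n,d}(Q)$ for all $Q \in SO(d)$ are $\{0\}$ and $\mathcal H_n^d$. For $d \ge 2$ the space $\mathcal H_n^d$ is moreover nonzero. (2) Let $d \ge 3$, $n \ge 0$ and $\lambda = \frac{d-2}{2}$, and let $$C_n^\lambda(t) = \frac{(\lambda)_n 2^n}{n!}\, t^n\, {}_2F_1\Big(-\tfrac n2, \tfrac{1-n}{2}; 1-n-\lambda; \tfrac1{t^2}\Big) = \frac{(\lambda)_n 2^n}{n!} \sum_{0 \le j \le n/2} \frac{(-\frac n2)_j (\frac{1-n}2)_j}{j!\,(1-n-\lambda)_j}\,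 t^{n-2j}$$ be the Gegenbauer polynomial, where $(a)_j = a(a+1)\cdots(a+j-1)$. Then the function $x \mapsto \|x\|^n C_n^\lambda(x_d/\|x\|)$, $x \ne 0$, is given by an element of $\mathcal H_n^d$, and an element $Y \in \mathcal H_n^d$ satisfies $T_{n,d}(Q) Y = Y$ for every $Q \in SO(d)$ with $Q e_d = e_d$, where $e_d = (0,\ldots,0,1)$, if and only if there is a constant $c \in \mathbb R$ with $$Y(x) = c\, \|x\|^n\, C_n^\lambda\Big(\frac{x_d}{\|x\|}\Big) \qquad \text{for all } x \ne 0.$$ -/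

import Mathlib

open scoped Nat

noncomputable section

namespace SphericalHarmonics

open MvPolynomial

/-- The Laplace operator `∂₁² + ⋯ + ∂_d²` on real polynomials in `d` variables. -/
def laplacian (d : ℕ) : MvPolynomial (Fin d) ℝ →ₗ[ℝ] MvPolynomial (Fin d) ℝ :=
  ∑ i : Fin d, (pderiv i).toLinearMap ∘ₗ (pderiv i).toLinearMap

/-- The space of real harmonic polynomials on `ℝ^d` that are homogeneous of degree `n`. -/
def harmonics (d n : ℕ) : Submodule ℝ (MvPolynomial (Fin d) ℝ) :=
  homogeneousSubmodule (Fin d) ℝ n ⊓ LinearMap.ker (laplacian d)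

/-- The polynomial `x ↦ f (A x)` for a square matrix `A`. -/
def compMatrix {d : ℕ} (A : Matrix (Fin d) (Fin d) ℝ) :
    MvPolynomial (Fin d) ℝ →ₐ[ℝ] MvPolynomial (Fin d) ℝ :=
  bind₁ A.toMvPolynomial

theorem eval_compMatrix {d : ℕ} (A : Matrix (Fin d) (Fin d) ℝ) (f : MvPolynomial (Fin d) ℝ)
    (x : Fin d → ℝ) : eval x (compMatrix A f) = eval (A.mulVec x) f := by
  have h : (eval x : MvPolynomial (Fin d) ℝ →+* ℝ) = eval₂Hom (RingHom.id ℝ) x := rfl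
  rw [h, compMatrix, eval₂Hom_bind₁]
  have h2 : (fun i => eval₂Hom (RingHom.id ℝ) x (A.toMvPolynomial i)) = A.mulVec x := by
    funext i
    exact A.toMvPolynomial_eval_eq_apply i x
  rw [h2]
  rfl

theorem compMatrix_one {d : ℕ} (f : MvPolynomial (Fin d) ℝ) : compMatrix 1 f = f := by
  simp [compMatrix]

theorem compMatrix_mul {d : ℕ} (A B : Matrix (Fin d) (Fin d) ℝ) (f : MvPolynomial (Fin d) ℝ) :
    compMatrix (A * B) f = compMatrix B (compMatrix A f) := by
  rw [compMatrix, compMatrix, compMatrix, bind₁_bind₁]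
  congr 2
  funext i
  exact Matrix.toMvPolynomial_mul A B i

theorem pderiv_compMatrix {d : ℕ} (A : Matrix (Fin d) (Fin d) ℝ) (i : Fin d)
    (f : MvPolynomial (Fin d) ℝ) :
    pderiv i (compMatrix A f) = ∑ j, A j i • compMatrix A (pderiv j f) := by
  induction f using MvPolynomial.induction_on with
  | C a => simp [compMatrix]
  | add p q hp hq => simp [hp, hq, Finset.sum_add_distrib]
  | mul_X p k hp =>
    have hX : pderiv i (compMatrix A (X k)) = C (A k i) := by
      simp [compMatrix, Matrix.toMvPolynomial, pderiv_monomial, Finsupp.single_apply,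
        apply_ite, Finset.sum_ite_eq']
    rw [map_mul, Derivation.leibniz, hp, hX]
    simp only [Derivation.leibniz, pderiv_X, smul_eq_mul, map_add, map_mul, Pi.single_apply,
      smul_add, Finset.sum_add_distrib]
    congr 1
    · rw [Finset.sum_eq_single k]
      · simp [MvPolynomial.smul_eq_C_mul, mul_comm]
      · intro b _ hb
        simp [hb.symm]
      · simp
    · rw [Finset.mul_sum]
      exact Finset.sum_congr rfl fun j _ => by rw [mul_smul_comm]

theorem laplacian_compMatrix {d : ℕ} (A : Matrix (Fin d) (Fin d) ℝ) (hA : A * A.transpose = 1)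
    (f : MvPolynomial (Fin d) ℝ) :
    laplacian d (compMatrix A f) = compMatrix A (laplacian d f) := by
  have h (j k : Fin d) : ∑ i, A j i * A k i = if j = k then 1 else 0 := by
    have := congrFun (congrFun hA j) k
    simpa [Matrix.mul_apply, Matrix.one_apply] using this
  simp only [laplacian, LinearMap.sum_apply, LinearMap.comp_apply, Derivation.coeFn_coe, pderiv_compMatrix, map_sum, Derivation.map_smul, Finset.smul_sum,
    smul_smul]
  rw [Finset.sum_comm]
  refine Finset.sum_congr rfl fun j _ => ?_
  rw [Finset.sum_comm]
  simp_rw [← Finset.sum_smul, h]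
  simp

theorem compMatrix_mem_harmonics {d n : ℕ} (A : Matrix (Fin d) (Fin d) ℝ)
    (hA : A * A.transpose = 1) {f : MvPolynomial (Fin d) ℝ} (hf : f ∈ harmonics d n) :
    compMatrix A f ∈ harmonics d n := by
  obtain ⟨h1, h2⟩ := hf
  refine ⟨?_, ?_⟩
  · have := (show f.IsHomogeneous n from h1).aeval A.toMvPolynomial
      (fun i => A.toMvPolynomial_isHomogeneous i)
    rw [one_mul] at this
    exact this
  · change laplacian d (compMatrix A f) = 0
    rw [laplacian_compMatrix A hA, show laplacian d f = 0 from h2, map_zero]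

theorem mul_transpose_of_mem {d : ℕ} (Q : Matrix.specialOrthogonalGroup (Fin d) ℝ) :
    (Q : Matrix (Fin d) (Fin d) ℝ) * (Q : Matrix (Fin d) (Fin d) ℝ).transpose = 1 :=
  Matrix.mem_orthogonalGroup_iff (Fin d) ℝ |>.1 (Matrix.mem_specialOrthogonalGroup_iff.1 Q.2).1

/-- The representation of `SO(d)` on the harmonic polynomials of degree `n`,
`(T(Q) f)(x) = f (Q⁻¹ x)`. -/
def harmonicRep (d n : ℕ) :
    Representation ℝ (Matrix.specialOrthogonalGroup (Fin d) ℝ) (harmonics d n) where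
  toFun Q := (compMatrix ((Q⁻¹ : Matrix.specialOrthogonalGroup (Fin d) ℝ) :
      Matrix (Fin d) (Fin d) ℝ)).toLinearMap.restrict
    fun _ hf => compMatrix_mem_harmonics _ (mul_transpose_of_mem Q⁻¹) hf
  map_one' := by
    ext1 f
    apply Subtype.ext
    simp [LinearMap.restrict_apply, compMatrix_one]
  map_mul' P Q := by
    ext1 f
    apply Subtype.ext
    simp only [mul_inv_rev, Submonoid.coe_mul, LinearMap.coe_restrict_apply,
      AlgHom.toLinearMap_apply, compMatrix_mul, Module.End.mul_apply]
    rfl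

theorem eval_harmonicRep (d n : ℕ) (Q : Matrix.specialOrthogonalGroup (Fin d) ℝ)
    (f : harmonics d n) (x : Fin d → ℝ) :
    eval x (harmonicRep d n Q f : MvPolynomial (Fin d) ℝ) =
      eval (((Q⁻¹ : Matrix.specialOrthogonalGroup (Fin d) ℝ) :
        Matrix (Fin d) (Fin d) ℝ).mulVec x) (f : MvPolynomial (Fin d) ℝ) :=
  eval_compMatrix _ _ _

/-- The Gegenbauer polynomial
`C_n^lam (t) = (lam)_n 2^n / n! * t^n * ₂F₁(-n/2, (1-n)/2; 1-n-lam; 1/t²)`,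
written out as a polynomial in `t`: the hypergeometric series ends at `j = ⌊n/2⌋`. -/
def gegenbauer (n : ℕ) (lam : ℝ) : Polynomial ℝ :=
  ∑ j ∈ Finset.range (n / 2 + 1),
    Polynomial.monomial (n - 2 * j)
      ((ascPochhammer ℝ n).eval lam * 2 ^ n / (n ! : ℝ) *
        ((ascPochhammer ℝ j).eval (-(n : ℝ) / 2) * (ascPochhammer ℝ j).eval ((1 - (n : ℝ)) / 2) /
          ((ascPochhammer ℝ j).eval (1 - (n : ℝ) - lam) * (j ! : ℝ))))

end SphericalHarmonics

end

open scoped Nat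
noncomputable section
namespace SphericalHarmonics
open MvPolynomial

/-! Everything rests on the Fischer inner product. It is positive definite, rotations are orthogonal
for it, multiplication by `X i` is adjoint to `pderiv i`, and hence multiplication by r² = ∑ xᵢ² is
adjoint to the Laplacian. Harmonics are therefore orthogonal to all multiples of r²: a harmonic `f`
that is congruent modulo r² to some `p` orthogonal to `f` is zero (`eq_zero_of_normSqPoly_dvd_sub`).

For d ≥ 3, a homogeneous polynomial fixed by the stabilizer of e_k is congruent to c x_kⁿ modulo r²,
and pairing with x_kⁿ is n! times evaluation at e_k. So an invariant harmonic is determined by its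
value at e_k (`eq_zero_of_invariant_of_eval_eq_zero`), and the invariant harmonics form a space of
dimension at most one. A nonzero invariant subspace W contains a nonzero such element, namely the
representer of evaluation at e_k. Hence W contains the reproducing element of the full space, and
its rotates leave no nonzero harmonic orthogonal to W.

For n = 0 or d = 1, evaluation at one point is injective. For d = 2 the dimension is at most 2, and
an invariant line would be fixed by all squares of rotations, that is, by all rotations, which is
impossible for n > 0.

For the Gegenbauer statement, ‖x‖ⁿ C(x_k/‖x‖) is expanded in x_k and r². The hypergeometric
recursion for the coefficients is exactly the vanishing of its Laplacian. This polynomial is nonzero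
and invariant, so it spans the invariant harmonics. -/

variable {d n : ℕ}

/-! ### The Fischer inner product. -/

/-- The Fischer form `∑ α! f_α g_α` on real polynomials. -/
def fischer (d : ℕ) : MvPolynomial (Fin d) ℝ →ₗ[ℝ] MvPolynomial (Fin d) ℝ →ₗ[ℝ] ℝ :=
  (basisMonomials (Fin d) ℝ).constr ℝ fun α => ((∏ i, (α i)! : ℕ) : ℝ) • lcoeff ℝ α


theorem fischer_monomial (α : Fin d →₀ ℕ) (a : ℝ) (g : MvPolynomial (Fin d) ℝ) :
    fischer d (monomial α a) g = a * ((∏ i, (α i)! : ℕ) : ℝ) * coeff α g := by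
  have h : monomial α a = a • basisMonomials (Fin d) ℝ α := by
    simp [smul_monomial]
  rw [h, map_smul, fischer, Module.Basis.constr_basis]
  simp [mul_assoc]

theorem fischer_apply (f g : MvPolynomial (Fin d) ℝ) :
    fischer d f g = ∑ α ∈ f.support, coeff α f * ((∏ i, (α i)! : ℕ) : ℝ) * coeff α g := by
  conv_lhs => rw [f.as_sum]
  simp only [map_sum, LinearMap.sum_apply, fischer_monomial]

theorem fischer_comm (f g : MvPolynomial (Fin d) ℝ) : fischer d f g = fischer d g f := by
  classical
  induction f using MvPolynomial.induction_on' with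
  | add p q hp hq => simp [hp, hq]
  | monomial α a =>
    induction g using MvPolynomial.induction_on' with
    | add p q hp hq => simp [hp, hq]
    | monomial β b =>
      rw [fischer_monomial, fischer_monomial, coeff_monomial, coeff_monomial]
      by_cases h : α = β
      · subst h; simp only [if_true]; ring
      · simp [h, Ne.symm h]

theorem eq_zero_of_fischer_self {f : MvPolynomial (Fin d) ℝ} (h : fischer d f f = 0) : f = 0 := by
  rw [fischer_apply, Finset.sum_eq_zero_iff_of_nonneg] at h
  · by_contra hf
    obtain ⟨α, hα⟩ := (support_nonempty (p := f)).2 hf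
    have h0 := h α hα
    have h1 : coeff α f ≠ 0 := mem_support_iff.1 hα
    have h2 : ((∏ i, (α i)! : ℕ) : ℝ) ≠ 0 := by
      exact_mod_cast (Finset.prod_pos fun i _ => Nat.factorial_pos (α i)).ne'
    exact mul_ne_zero (mul_ne_zero h1 h2) h1 h0
  · intro α _
    have : coeff α f * ((∏ i, (α i)! : ℕ) : ℝ) * coeff α f
        = coeff α f ^ 2 * ((∏ i, (α i)! : ℕ) : ℝ) := by ring
    rw [this]
    positivity

theorem fischer_X_mul (i : Fin d) (f g : MvPolynomial (Fin d) ℝ) :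
    fischer d (X i * f) g = fischer d f (pderiv i g) := by
  classical
  induction f using MvPolynomial.induction_on' with
  | add p q hp hq => simp [mul_add, hp, hq]
  | monomial α a =>
    have h : X i * monomial α a = monomial (α + Finsupp.single i 1) a := by
      rw [mul_comm, X, monomial_mul, mul_one]
    rw [h, fischer_monomial, fischer_monomial, coeff_pderiv]
    have h2 : ∏ j, ((α + Finsupp.single i 1 : Fin d →₀ ℕ) j)! = (α i + 1) * ∏ j, (α j)! := by
      rw [← Finset.mul_prod_erase _ _ (Finset.mem_univ i),
        ← Finset.mul_prod_erase _ (fun j => (α j)!) (Finset.mem_univ i), ← mul_assoc]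
      congr 1
      · simp [Nat.factorial_succ]
      · refine Finset.prod_congr rfl fun j hj => ?_
        simp [(Finset.ne_of_mem_erase hj).symm]
    rw [h2]
    push_cast
    ring

/-- Induction on `f`: multiplication by a variable moves across the form as a derivative, and the
chain rule produces the transpose. For orthogonal `A` this makes `compMatrix A` an isometry. -/
theorem fischer_compMatrix (A : Matrix (Fin d) (Fin d) ℝ) (f g : MvPolynomial (Fin d) ℝ) :
    fischer d (compMatrix A f) g = fischer d f (compMatrix A.transpose g) := by
  induction f using MvPolynomial.induction_on generalizing g with
  | C a =>
    have h1 : compMatrix A (C a) = monomial 0 a := by simp [compMatrix]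
    have h2 : coeff 0 (compMatrix A.transpose g) = coeff 0 g := by
      have := eval_compMatrix A.transpose g 0
      simpa [← constantCoeff_eq, ← eval_zero'] using this
    rw [h1, fischer_monomial, ← h2, ← monomial_zero', fischer_monomial]
  | add p q hp hq => simp [hp, hq]
  | mul_X p k hp =>
    have hX : compMatrix A (X k) = ∑ j, A k j • X j := by
      simp [compMatrix, Matrix.toMvPolynomial, smul_eq_C_mul, C_mul_X_eq_monomial]
    rw [map_mul, hX, mul_comm, mul_comm p, fischer_X_mul, pderiv_compMatrix, Finset.sum_mul]
    simp only [map_sum, LinearMap.sum_apply, smul_mul_assoc, map_smul, LinearMap.smul_apply,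
      fischer_X_mul, hp, Matrix.transpose_apply]

/-- The polynomial `∑ xᵢ²`. -/
def normSqPoly (d : ℕ) : MvPolynomial (Fin d) ℝ := ∑ i, X i ^ 2

theorem eval_normSqPoly (x : Fin d → ℝ) : eval x (normSqPoly d) = ∑ i, x i ^ 2 := by
  simp [normSqPoly]

theorem fischer_normSqPoly_mul (f g : MvPolynomial (Fin d) ℝ) :
    fischer d (normSqPoly d * f) g = fischer d f (laplacian d g) := by
  simp only [normSqPoly, Finset.sum_mul, map_sum, LinearMap.sum_apply, laplacian, pow_two,
    mul_assoc, fischer_X_mul]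
  rfl

/-- Writing f = p + r² g gives ⟨f, f⟩ = ⟨p, f⟩ + ⟨g, Δf⟩ = 0. -/
theorem eq_zero_of_normSqPoly_dvd_sub {f p : MvPolynomial (Fin d) ℝ} (hf : f ∈ harmonics d n)
    (hdvd : normSqPoly d ∣ f - p) (hp : fischer d p f = 0) : f = 0 := by
  obtain ⟨g, hg⟩ := hdvd
  apply eq_zero_of_fischer_self
  have h0 : laplacian d f = 0 := hf.2
  have h : f = p + normSqPoly d * g := by rw [← hg]; ring
  have h2 : fischer d f f = fischer d (p + normSqPoly d * g) f := by rw [← h]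
  rw [h2, map_add, LinearMap.add_apply, fischer_normSqPoly_mul, h0, hp]
  simp

/-! ### Values of homogeneous polynomials and orthogonal projection. -/

theorem eval_smul_of_isHomogeneous {f : MvPolynomial (Fin d) ℝ} (hf : f.IsHomogeneous n)
    (s : ℝ) (x : Fin d → ℝ) : eval (s • x) f = s ^ n * eval x f := by
  rw [eval_eq', eval_eq', Finset.mul_sum]
  refine Finset.sum_congr rfl fun α hα => ?_
  have h := hf.degree_eq_sum_deg_support hα
  have h' : n = ∑ i, α i := by
    rw [h]
    exact Finsupp.sum_fintype α (fun _ a => a) (fun _ => rfl)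
  simp only [Pi.smul_apply, smul_eq_mul, mul_pow, Finset.prod_mul_distrib,
    Finset.prod_pow_eq_pow_sum, ← h']
  ring

theorem eval_single_of_isHomogeneous {f : MvPolynomial (Fin d) ℝ} (hf : f.IsHomogeneous n)
    (k : Fin d) : eval (Pi.single k 1) f = coeff (Finsupp.single k n) f := by
  classical
  rw [eval_eq']
  rw [Finset.sum_eq_single (Finsupp.single k n)]
  · have : ∏ i, (Pi.single k 1 : Fin d → ℝ) i ^ (Finsupp.single k n) i = 1 := by
      refine Finset.prod_eq_one fun i _ => ?_
      by_cases h : i = k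
      · subst h; simp
      · simp [Ne.symm h]
    rw [this, mul_one]
  · intro α hα hne
    have h := hf.degree_eq_sum_deg_support hα
    have h' : n = ∑ i, α i := by
      rw [h]
      exact Finsupp.sum_fintype α (fun _ a => a) (fun _ => rfl)
    have : ∃ i, i ≠ k ∧ α i ≠ 0 := by
      by_contra! hcon
      apply hne
      have hk : α k = n := by
        rw [h', Finset.sum_eq_single k (fun i _ hi => hcon i hi) (by simp)]
      ext i
      by_cases hi : i = k
      · subst hi; simp [hk]
      · simp [Ne.symm hi, hcon i hi]
    obtain ⟨i, hi, hi0⟩ := this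
    rw [Finset.prod_eq_zero (Finset.mem_univ i), mul_zero]
    simp [hi, hi0]
  · intro h
    simp [notMem_support_iff.1 h]

theorem fischer_X_pow {f : MvPolynomial (Fin d) ℝ} (hf : f.IsHomogeneous n) (k : Fin d) :
    fischer d (X k ^ n) f = n ! * eval (Pi.single k 1) f := by
  classical
  rw [eval_single_of_isHomogeneous hf, X_pow_eq_monomial, fischer_monomial,
    ← Finset.mul_prod_erase _ _ (Finset.mem_univ k), Finset.prod_eq_one]
  · simp
  · intro i hi
    simp [(Finset.ne_of_mem_erase hi).symm]

/-- Definiteness makes the form restricted to `W` nondegenerate, so every functional on `W` is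
represented in `W`. -/
theorem exists_fischer_projection (W : Submodule ℝ (MvPolynomial (Fin d) ℝ))
    [FiniteDimensional ℝ W] (h : MvPolynomial (Fin d) ℝ) :
    ∃ u ∈ W, ∀ f ∈ W, fischer d u f = fischer d h f := by
  let B : W →ₗ[ℝ] Module.Dual ℝ W := (fischer d).domRestrict₁₂ W W
  have hinj : Function.Injective B := by
    rw [← LinearMap.ker_eq_bot, LinearMap.ker_eq_bot']
    intro w hw
    exact Subtype.ext (eq_zero_of_fischer_self (LinearMap.congr_fun hw w))
  have hsurj := (LinearMap.injective_iff_surjective_of_finrank_eq_finrank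
    (Subspace.dual_finrank_eq (K := ℝ) (V := W)).symm).1 hinj
  obtain ⟨u, hu⟩ := hsurj ((fischer d h).domRestrict W)
  exact ⟨u, u.2, fun f hf => LinearMap.congr_fun hu ⟨f, hf⟩⟩

instance finiteDimensional_harmonics : FiniteDimensional ℝ (harmonics d n) := by
  have : FiniteDimensional ℝ (homogeneousSubmodule (Fin d) ℝ n) :=
    Module.Finite.iff_fg.2 (homogeneousSubmodule_fg (R := ℝ) (σ := Fin d) n)
  exact Submodule.finiteDimensional_of_le (inf_le_left : harmonics d n ≤ _)

/-! ### Rotations. -/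

open Matrix in
/-- Vectors of equal length are related by a rotation, which may be taken to fix any vector
with the same inner products with both and vanishing in a coordinate where the target does. -/
theorem exists_rotation {x y : Fin d → ℝ} (h : x ⬝ᵥ x = y ⬝ᵥ y) (j : Fin d) (hy : y j = 0) :
    ∃ A ∈ Matrix.specialOrthogonalGroup (Fin d) ℝ, A *ᵥ x = y ∧
      ∀ w : Fin d → ℝ, w ⬝ᵥ x = w ⬝ᵥ y → w j = 0 → A *ᵥ w = w := by
  by_cases hxy : x = y
  · exact ⟨1, one_mem _, by simp [hxy], by simp⟩
  -- `H` is the reflection in the hyperplane orthogonal to x - y; it swaps `x` and `y` and fixes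
  -- every vector orthogonal to x - y.
  set v := x - y with hv
  have hv0 : v ⬝ᵥ v ≠ 0 := by
    rw [Ne, dotProduct_self_eq_zero]
    exact sub_ne_zero.2 hxy
  set H : Matrix (Fin d) (Fin d) ℝ := 1 - (2 / (v ⬝ᵥ v)) • vecMulVec v v with hH
  have hHmul (w : Fin d → ℝ) : H *ᵥ w = w - (2 / (v ⬝ᵥ v) * (v ⬝ᵥ w)) • v := by
    rw [hH, sub_mulVec, one_mulVec, smul_mulVec, vecMulVec_mulVec]
    simp [smul_smul]
  have hHx : H *ᵥ x = y := by
    have h2 : v ⬝ᵥ v = 2 * (v ⬝ᵥ x) := by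
      have hc : y ⬝ᵥ x = x ⬝ᵥ y := dotProduct_comm _ _
      simp only [hv, sub_dotProduct, dotProduct_sub]
      linarith
    have h3 : 2 / (v ⬝ᵥ v) * (v ⬝ᵥ x) = 1 := by
      have : v ⬝ᵥ x ≠ 0 := fun h0 => hv0 (by rw [h2, h0, mul_zero])
      rw [h2]; field_simp
    rw [hHmul, h3, one_smul, hv, sub_sub_cancel]
  have hHw (w : Fin d → ℝ) (hw : w ⬝ᵥ x = w ⬝ᵥ y) : H *ᵥ w = w := by
    have : v ⬝ᵥ w = 0 := by
      rw [hv, sub_dotProduct, dotProduct_comm x, dotProduct_comm y, hw, sub_self]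
    rw [hHmul, this]; simp
  have hHT : Hᵀ = H := by
    rw [hH, transpose_sub, transpose_one, transpose_smul, transpose_vecMulVec]
  have hHO : H ∈ orthogonalGroup (Fin d) ℝ := by
    rw [mem_orthogonalGroup_iff, hHT]
    have hvv : vecMulVec v v * vecMulVec v v = (v ⬝ᵥ v) • vecMulVec v v := by
      rw [vecMulVec_mul_vecMulVec, vecMulVec_smul]
    have : H * H = 1 - (2 * (2 / (v ⬝ᵥ v)) - (2 / (v ⬝ᵥ v)) ^ 2 * (v ⬝ᵥ v)) •
        vecMulVec v v := by
      rw [hH]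
      simp only [sub_mul, mul_sub, one_mul, mul_one, smul_mul_assoc, mul_smul_comm, hvv]
      module
    rw [this]
    have : 2 * (2 / (v ⬝ᵥ v)) - (2 / (v ⬝ᵥ v)) ^ 2 * (v ⬝ᵥ v) = 0 := by
      field_simp; ring
    rw [this]; simp
  have hdet : H.det = 1 ∨ H.det = -1 := by
    have := congrArg Matrix.det ((mem_orthogonalGroup_iff _ _).1 hHO)
    rw [det_mul, det_transpose, det_one] at this
    exact mul_self_eq_one_iff.1 this
  rcases hdet with hdet | hdet
  · exact ⟨H, mem_specialOrthogonalGroup_iff.2 ⟨hHO, hdet⟩, hHx, fun w hw _ => hHw w hw⟩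
  -- The determinant is corrected by flipping the sign of coordinate `j`, which moves neither `y`
  -- nor any `w` with `w j = 0`.
  set e : Fin d → ℝ := Function.update 1 j (-1) with he
  have hD (w : Fin d → ℝ) (hw : w j = 0) : diagonal e *ᵥ w = w := by
    ext i
    rw [mulVec_diagonal]
    by_cases hi : i = j
    · subst hi; simp [hw]
    · simp [he, hi]
  refine ⟨diagonal e * H, mem_specialOrthogonalGroup_iff.2 ⟨mul_mem ?_ hHO, ?_⟩, ?_, ?_⟩
  · rw [mem_orthogonalGroup_iff, diagonal_transpose, diagonal_mul_diagonal, ← diagonal_one]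
    congr 1
    ext i
    by_cases hi : i = j
    · subst hi; simp [he]
    · simp [he, hi]
  · rw [det_mul, hdet, det_diagonal, he, Finset.prod_update_of_mem (Finset.mem_univ j)]
    simp
  · rw [← mulVec_mulVec, hHx, hD y hy]
  · intro w hw hwj
    rw [← mulVec_mulVec, hHw w hw, hD w hwj]

theorem transpose_mem {A : Matrix (Fin d) (Fin d) ℝ}
    (hA : A ∈ Matrix.specialOrthogonalGroup (Fin d) ℝ) :
    A.transpose ∈ Matrix.specialOrthogonalGroup (Fin d) ℝ := by
  rw [Matrix.mem_specialOrthogonalGroup_iff] at hA ⊢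
  refine ⟨?_, by rw [Matrix.det_transpose, hA.2]⟩
  rw [Matrix.mem_orthogonalGroup_iff, Matrix.transpose_transpose]
  exact (Matrix.mem_orthogonalGroup_iff' _ _).1 hA.1

theorem mul_transpose_eq_one {A : Matrix (Fin d) (Fin d) ℝ}
    (hA : A ∈ Matrix.specialOrthogonalGroup (Fin d) ℝ) : A * A.transpose = 1 :=
  mul_transpose_of_mem ⟨A, hA⟩

theorem compMatrix_transpose_compMatrix {A : Matrix (Fin d) (Fin d) ℝ}
    (hA : A ∈ Matrix.specialOrthogonalGroup (Fin d) ℝ) (f : MvPolynomial (Fin d) ℝ) :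
    compMatrix A.transpose (compMatrix A f) = f := by
  rw [← compMatrix_mul, mul_transpose_eq_one hA, compMatrix_one]

theorem mulVec_transpose_eq {A : Matrix (Fin d) (Fin d) ℝ}
    (hA : A ∈ Matrix.specialOrthogonalGroup (Fin d) ℝ) {x y : Fin d → ℝ} (h : A.mulVec x = y) :
    A.transpose.mulVec y = x := by
  have := mul_transpose_eq_one (transpose_mem hA)
  rw [Matrix.transpose_transpose] at this
  rw [← h, Matrix.mulVec_mulVec, this, Matrix.one_mulVec]

/-- A nonzero homogeneous polynomial is nonzero at `e_k` after a suitable rotation. -/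
theorem exists_eval_compMatrix_ne_zero (hd : 2 ≤ d) (k : Fin d) {f : MvPolynomial (Fin d) ℝ}
    (hf : f.IsHomogeneous n) (hf0 : f ≠ 0) :
    ∃ A ∈ Matrix.specialOrthogonalGroup (Fin d) ℝ,
      eval (Pi.single k 1) (compMatrix A f) ≠ 0 := by
  have : Nontrivial (Fin d) := Fin.nontrivial_iff_two_le.2 hd
  obtain ⟨j, hj⟩ := exists_ne k
  obtain ⟨x, hx⟩ : ∃ x, eval x f ≠ 0 := by
    by_contra! h
    exact hf0 (MvPolynomial.funext fun x => by simp [h x])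
  set s := Real.sqrt (dotProduct x x) with hs
  have hss : s * s = dotProduct x x := Real.mul_self_sqrt (by
    simpa using dotProduct_star_self_nonneg x)
  obtain ⟨A, hA, hAx, -⟩ := exists_rotation (x := x) (y := s • Pi.single k 1)
    (by simp [hss]) j (by simp [hj])
  refine ⟨A.transpose, transpose_mem hA, fun h0 => hx ?_⟩
  rw [eval_compMatrix] at h0
  rw [← mulVec_transpose_eq hA hAx, Matrix.mulVec_smul, eval_smul_of_isHomogeneous hf, h0,
    mul_zero]

/-! ### Polynomials invariant under the stabilizer of e_k, for d ≥ 3. -/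

/-- Polynomials that depend only on `xₖ` and evenly on the distance to the `k`-th axis are
congruent to a multiple of `xₖⁿ` modulo `∑ xᵢ²`. -/
theorem exists_normSqPoly_dvd_sub_of_invariant (hd : 3 ≤ d) (k : Fin d)
    {f : MvPolynomial (Fin d) ℝ} (hf : f.IsHomogeneous n)
    (hinv : ∀ A ∈ Matrix.specialOrthogonalGroup (Fin d) ℝ,
      A.mulVec (Pi.single k 1) = Pi.single k 1 → compMatrix A f = f) :
    ∃ c : ℝ, normSqPoly d ∣ f - C c * X k ^ n := by
  classical
  obtain ⟨i, hik⟩ : ∃ i, i ≠ k := by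
    have : Nontrivial (Fin d) := Fin.nontrivial_iff_two_le.2 (by omega)
    exact exists_ne k
  -- This is where d ≥ 3 enters: the sign flip needs a coordinate outside the plane of e_i and e_k.
  obtain ⟨j, hj⟩ : ∃ j, j ∉ ({i, k} : Finset (Fin d)) := by
    by_contra! h
    have h1 := Finset.card_le_card (fun x _ => h x : (Finset.univ : Finset (Fin d)) ⊆ {i, k})
    have h2 := Finset.card_le_two (a := i) (b := k)
    simp only [Finset.card_univ, Fintype.card_fin] at h1
    omega
  obtain ⟨hji, hjk⟩ : j ≠ i ∧ j ≠ k := by simpa using hj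
  have key (x : Fin d → ℝ) (s : ℝ) (hs : s ^ 2 = ∑ l, x l ^ 2 - x k ^ 2) :
      eval x f = eval (s • Pi.single i 1 + x k • Pi.single k 1 : Fin d → ℝ) f := by
    obtain ⟨A, hA, hAx, hfix⟩ := exists_rotation (x := x)
      (y := s • Pi.single i 1 + x k • Pi.single k 1) (by
        simp only [add_dotProduct, dotProduct_add, smul_dotProduct, dotProduct_smul,
          single_dotProduct, Pi.single_apply, hik, hik.symm]
        simp only [dotProduct, ← pow_two]
        simp
        linarith) j (by simp [hji, hjk])
    have h1 := hinv A hA (hfix _ (by simp [hik.symm]) (by simp [hjk]))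
    rw [← hAx, ← eval_compMatrix, h1]
  -- Only monomials in x_i and x_k alone survive on the plane of e_i and e_k.
  set b : (Fin d →₀ ℕ) → ℝ := fun α => if α i + α k = n then coeff α f else 0 with hb
  have hplane (s t : ℝ) : eval (s • Pi.single i 1 + t • Pi.single k 1 : Fin d → ℝ) f =
      ∑ α ∈ f.support, b α * (s ^ α i * t ^ α k) := by
    rw [eval_eq']
    refine Finset.sum_congr rfl fun α hα => ?_
    have h := hf.degree_eq_sum_deg_support hα
    have h' : n = ∑ i, α i := by
      rw [h]
      exact Finsupp.sum_fintype α (fun _ a => a) (fun _ => rfl)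
    have hk : k ∈ Finset.univ.erase i := by simp [hik.symm]
    rw [← Finset.add_sum_erase _ _ (Finset.mem_univ i), ← Finset.add_sum_erase _ _ hk] at h'
    rw [← Finset.mul_prod_erase _ _ (Finset.mem_univ i), ← Finset.mul_prod_erase _ _ hk]
    have hzero : ∀ l ∈ (Finset.univ.erase i).erase k,
        (s • Pi.single i 1 + t • Pi.single k 1 : Fin d → ℝ) l = 0 := by
      intro l hl
      simp only [Finset.mem_erase] at hl
      simp [hl.1, hl.2.1]
    by_cases hn : α i + α k = n
    · have h0 : ∑ l ∈ (Finset.univ.erase i).erase k, α l = 0 := by omega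
      rw [Finset.sum_eq_zero_iff] at h0
      rw [Finset.prod_eq_one fun l hl => by rw [h0 l hl, pow_zero]]
      simp [hb, hn, hik, hik.symm]
    · have h0 : ∑ l ∈ (Finset.univ.erase i).erase k, α l ≠ 0 := by omega
      obtain ⟨l, hl, hl0⟩ := Finset.exists_ne_zero_of_sum_ne_zero h0
      rw [Finset.prod_eq_zero hl (by rw [hzero l hl, zero_pow hl0])]
      simp [hb, hn]
  have hpoly : f = ∑ α ∈ f.support, C (b α) * ((if Even (α i) then
      (normSqPoly d - X k ^ 2) ^ (α i / 2) else 0) * X k ^ α k) := by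
    refine MvPolynomial.funext fun x => ?_
    have hnn : 0 ≤ ∑ l, x l ^ 2 - x k ^ 2 := by
      rw [← Finset.add_sum_erase _ _ (Finset.mem_univ k), add_sub_cancel_left]
      exact Finset.sum_nonneg fun l _ => sq_nonneg _
    set s := Real.sqrt (∑ l, x l ^ 2 - x k ^ 2) with hs
    have hs2 : s ^ 2 = ∑ l, x l ^ 2 - x k ^ 2 := Real.sq_sqrt hnn
    have h1 := key x s hs2
    have h2 := key x (-s) (by rw [neg_sq, hs2])
    rw [hplane] at h1 h2
    -- Averaging the expressions for `s` and `-s` removes the odd powers of `s`; the even ones are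
    -- polynomials in s² = r² - x_k².
    have h3 : eval x f = (eval x f + eval x f) / 2 := by ring
    rw [h3]
    nth_rewrite 1 [h1]
    rw [h2, ← Finset.sum_add_distrib, Finset.sum_div, map_sum]
    refine Finset.sum_congr rfl fun α _ => ?_
    by_cases he : Even (α i)
    · obtain ⟨m, hm⟩ := he
      have hm2 : α i / 2 = m := by omega
      have hm3 : α i = 2 * m := by omega
      rw [if_pos ⟨m, hm⟩, hm2, hm3]
      simp only [map_mul, map_pow, map_sub, eval_C, eval_X, eval_normSqPoly, ← hs2, pow_mul,
        neg_sq]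
      ring
    · rw [if_neg he, (Nat.not_even_iff_odd.1 he).neg_pow]
      simp
  set c : ℝ := ∑ α ∈ f.support, b α * (if Even (α i) then (-1) ^ (α i / 2) else 0) with hc
  refine ⟨c, ?_⟩
  have hsub : f - C c * X k ^ n = ∑ α ∈ f.support, (C (b α) * ((if Even (α i) then
      (normSqPoly d - X k ^ 2) ^ (α i / 2) else 0) * X k ^ α k) -
      C (b α * (if Even (α i) then (-1) ^ (α i / 2) else 0)) * X k ^ n) := by
    rw [Finset.sum_sub_distrib, ← hpoly, ← Finset.sum_mul, ← map_sum]
  rw [hsub]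
  refine Finset.dvd_sum fun α _ => ?_
  by_cases hn : α i + α k = n
  · by_cases he : Even (α i)
    · obtain ⟨m, hm⟩ := he
      have hm2 : α i / 2 = m := by omega
      have hm3 : n = 2 * m + α k := by omega
      rw [if_pos ⟨m, hm⟩, if_pos ⟨m, hm⟩, hm2, hm3]
      -- Modulo r², (r² - x_k²)^m is (-x_k²)^m, whence the signs in `c`.
      have hd := sub_dvd_pow_sub_pow (normSqPoly d - X k ^ 2) (-X k ^ 2) m
      rw [show normSqPoly d - X k ^ 2 - -X k ^ 2 = normSqPoly d by ring] at hd
      have : C (b α) * ((normSqPoly d - X k ^ 2) ^ m * X k ^ α k) -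
          C (b α * (-1) ^ m) * X k ^ (2 * m + α k) =
          ((normSqPoly d - X k ^ 2) ^ m - (-X k ^ 2) ^ m) * (C (b α) * X k ^ α k) := by
        rw [C_mul, C_pow, C_neg, C_1, neg_pow (X k ^ 2 : MvPolynomial (Fin d) ℝ), pow_add, pow_mul]
        ring
      rw [this]
      exact Dvd.dvd.mul_right hd _
    · simp [he]
  · simp [hb, hn]

theorem eq_zero_of_invariant_of_eval_eq_zero (hd : 3 ≤ d) (k : Fin d)
    {f : MvPolynomial (Fin d) ℝ} (hf : f ∈ harmonics d n)
    (hinv : ∀ A ∈ Matrix.specialOrthogonalGroup (Fin d) ℝ,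
      A.mulVec (Pi.single k 1) = Pi.single k 1 → compMatrix A f = f)
    (h0 : eval (Pi.single k 1) f = 0) : f = 0 := by
  obtain ⟨c, hc⟩ := exists_normSqPoly_dvd_sub_of_invariant hd k hf.1 hinv
  refine eq_zero_of_normSqPoly_dvd_sub hf hc ?_
  rw [← smul_eq_C_mul, map_smul, LinearMap.smul_apply, fischer_X_pow hf.1, h0]
  simp

/-! ### Irreducibility for d ≥ 3. -/

theorem compMatrix_mem_harmonics_of_mem {A : Matrix (Fin d) (Fin d) ℝ}
    (hA : A ∈ Matrix.specialOrthogonalGroup (Fin d) ℝ) {f : MvPolynomial (Fin d) ℝ}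
    (hf : f ∈ harmonics d n) : compMatrix A f ∈ harmonics d n :=
  compMatrix_mem_harmonics A (mul_transpose_eq_one hA) hf

/-- A nonzero invariant space of harmonics contains a nonzero element that is fixed by the
rotations fixing `e_k` and represents evaluation at `e_k`. -/
theorem exists_zonal_mem (hd : 2 ≤ d) (k : Fin d) {W : Submodule ℝ (MvPolynomial (Fin d) ℝ)}
    (hW : W ≤ harmonics d n) (hW0 : W ≠ ⊥)
    (hinv : ∀ A ∈ Matrix.specialOrthogonalGroup (Fin d) ℝ, ∀ f ∈ W, compMatrix A f ∈ W) :
    ∃ u ∈ W, u ≠ 0 ∧ (∀ A ∈ Matrix.specialOrthogonalGroup (Fin d) ℝ,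
      A.mulVec (Pi.single k 1) = Pi.single k 1 → compMatrix A u = u) ∧
      ∀ f ∈ W, fischer d u f = n ! * eval (Pi.single k 1) f := by
  have : FiniteDimensional ℝ W := Submodule.finiteDimensional_of_le hW
  -- The projection of x_kⁿ represents n! times evaluation at e_k. Uniqueness of the representer
  -- yields its invariance.
  obtain ⟨u, hu, hproj⟩ := exists_fischer_projection W (X k ^ n)
  have hrep (f) (hf : f ∈ W) : fischer d u f = n ! * eval (Pi.single k 1) f := by
    rw [hproj f hf, fischer_X_pow (hW hf).1]
  refine ⟨u, hu, ?_, ?_, hrep⟩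
  · rintro rfl
    obtain ⟨w, hw, hw0⟩ := Submodule.exists_mem_ne_zero_of_ne_bot hW0
    obtain ⟨A, hA, hne⟩ := exists_eval_compMatrix_ne_zero hd k (hW hw).1 hw0
    have h := hrep _ (hinv A hA w hw)
    rw [map_zero, LinearMap.zero_apply] at h
    exact mul_ne_zero (by exact_mod_cast n.factorial_ne_zero) hne h.symm
  · intro A hA hAk
    have horth (w) (hw : w ∈ W) : fischer d (compMatrix A u - u) w = 0 := by
      rw [map_sub, LinearMap.sub_apply, fischer_compMatrix,
        hrep _ (hinv _ (transpose_mem hA) w hw), hrep w hw, eval_compMatrix,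
        mulVec_transpose_eq hA hAk, sub_self]
    exact sub_eq_zero.1 (eq_zero_of_fischer_self
      (horth _ (W.sub_mem (hinv A hA u hu) hu)))

theorem harmonics_le_of_three_le (hd : 3 ≤ d) {W : Submodule ℝ (MvPolynomial (Fin d) ℝ)}
    (hW : W ≤ harmonics d n) (hW0 : W ≠ ⊥)
    (hinv : ∀ A ∈ Matrix.specialOrthogonalGroup (Fin d) ℝ, ∀ f ∈ W, compMatrix A f ∈ W) :
    harmonics d n ≤ W := by
  let k : Fin d := ⟨0, by omega⟩
  have : FiniteDimensional ℝ W := Submodule.finiteDimensional_of_le hW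
  obtain ⟨u, hu, hu0, huinv, -⟩ := exists_zonal_mem (by omega) k hW hW0 hinv
  obtain ⟨z, hz, -, hzinv, hzrep⟩ := exists_zonal_mem (n := n) (by omega) k le_rfl
    (fun h => hW0 (le_bot_iff.1 (h ▸ hW)))
    (fun A hA f hf => compMatrix_mem_harmonics_of_mem hA hf)
  have hue : eval (Pi.single k 1) u ≠ 0 := fun h =>
    hu0 (eq_zero_of_invariant_of_eval_eq_zero hd k (hW hu) huinv h)
  -- Both `z` and `u` are invariant, so matching their values at e_k makes them proportional.
  have hzW : z ∈ W := by
    set c := eval (Pi.single k 1) z / eval (Pi.single k 1) u with hc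
    have hzero : z - c • u = 0 := by
      refine eq_zero_of_invariant_of_eval_eq_zero hd k
        (Submodule.sub_mem _ hz (Submodule.smul_mem _ c (hW hu))) (fun A hA hAk => ?_) ?_
      · rw [map_sub, map_smul, hzinv A hA hAk, huinv A hA hAk]
      · rw [map_sub, smul_eval, hc]
        field_simp
        ring
    rw [sub_eq_zero.1 hzero]
    exact W.smul_mem c hu
  intro g hg
  -- The remainder g - v is orthogonal to `W`, hence to all rotates of `z`, so every rotate of it
  -- vanishes at e_k.
  obtain ⟨v, hv, hproj⟩ := exists_fischer_projection W g
  by_contra hgW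
  have hne : g - v ≠ 0 := fun h => hgW (sub_eq_zero.1 h ▸ hv)
  have hgv : g - v ∈ harmonics d n := Submodule.sub_mem _ hg (hW hv)
  obtain ⟨A, hA, hA0⟩ := exists_eval_compMatrix_ne_zero (by omega) k hgv.1 hne
  have h1 := hzrep _ (compMatrix_mem_harmonics_of_mem hA hgv)
  have h2 := hinv _ (transpose_mem hA) z hzW
  rw [fischer_comm, fischer_compMatrix, map_sub, LinearMap.sub_apply, hproj _ h2, sub_self] at h1
  exact mul_ne_zero (by exact_mod_cast n.factorial_ne_zero) hA0 h1.symm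

/-! ### Degree zero and dimensions one and two. -/

theorem harmonics_le_of_eval {W : Submodule ℝ (MvPolynomial (Fin d) ℝ)} (hW : W ≤ harmonics d n)
    (hW0 : W ≠ ⊥) (e : Fin d → ℝ) (he : ∀ f ∈ harmonics d n, eval e f = 0 → f = 0) :
    harmonics d n ≤ W := by
  obtain ⟨w, hw, hw0⟩ := Submodule.exists_mem_ne_zero_of_ne_bot hW0
  have hwe : eval e w ≠ 0 := fun h => hw0 (he w (hW hw) h)
  intro g hg
  have h := he (g - (eval e g / eval e w) • w)
    (Submodule.sub_mem _ hg (Submodule.smul_mem _ _ (hW hw)))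
    (by rw [map_sub, smul_eval]; field_simp; ring)
  rw [sub_eq_zero.1 h]
  exact W.smul_mem _ hw

theorem eq_zero_of_eval_eq_zero_of_degree_zero {f : MvPolynomial (Fin d) ℝ}
    (hf : f ∈ harmonics d 0) (h : eval 0 f = 0) : f = 0 := by
  have hf1 : f.IsHomogeneous 0 := hf.1
  refine MvPolynomial.funext fun x => ?_
  have h1 := eval_smul_of_isHomogeneous hf1 0 x
  rw [zero_smul, h] at h1
  simpa using h1.symm

theorem eq_zero_of_eval_eq_zero_of_dim_one {f : MvPolynomial (Fin 1) ℝ}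
    (hf : f ∈ harmonics 1 n) (h : eval 1 f = 0) : f = 0 := by
  refine MvPolynomial.funext fun x => ?_
  have hx : x = x 0 • (1 : Fin 1 → ℝ) := by
    ext i
    simp [Subsingleton.elim i 0]
  rw [hx, eval_smul_of_isHomogeneous hf.1, h]
  simp

theorem normSqPoly_two_dvd_monomial_sub (a b : ℕ) : ∃ (c : ℝ) (m : ℕ), m ≤ 1 ∧ m ≤ a + b ∧
    normSqPoly 2 ∣ (X 0 ^ a * X 1 ^ b - C c * (X 0 ^ m * X 1 ^ (a + b - m))) := by
  induction a using Nat.strong_induction_on generalizing b with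
  | _ a ih =>
    by_cases ha : a ≤ 1
    · exact ⟨1, a, ha, by omega, by simp⟩
    · obtain ⟨a, rfl⟩ : ∃ a', a = a' + 2 := ⟨a - 2, by omega⟩
      obtain ⟨c, m, hm, hma, h⟩ := ih a (by omega) (b + 2)
      refine ⟨-c, m, hm, by omega, ?_⟩
      have he : a + 2 + b - m = a + (b + 2) - m := by omega
      rw [he]
      have : (X 0 ^ (a + 2) * X 1 ^ b - C (-c) * (X 0 ^ m * X 1 ^ (a + (b + 2) - m)) :
          MvPolynomial (Fin 2) ℝ) = normSqPoly 2 * (X 0 ^ a * X 1 ^ b) -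
          (X 0 ^ a * X 1 ^ (b + 2) - C c * (X 0 ^ m * X 1 ^ (a + (b + 2) - m))) := by
        simp only [normSqPoly, Fin.sum_univ_two, C_neg]
        ring
      rw [this]
      exact dvd_sub (dvd_mul_right _ _) h

/-- Modulo r² = x² + y², every monomial of degree n is a multiple of yⁿ or x yⁿ⁻¹, so the pairings
with these two determine a harmonic. -/
theorem finrank_harmonics_two_le : Module.finrank ℝ (harmonics 2 n) ≤ 2 := by
  let L : harmonics 2 n →ₗ[ℝ] (Fin 2 → ℝ) := LinearMap.pi fun m =>
    (fischer 2 (X 0 ^ (m : ℕ) * X 1 ^ (n - m))).comp (harmonics 2 n).subtype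
  have hL : Function.Injective L := by
    rw [← LinearMap.ker_eq_bot, LinearMap.ker_eq_bot']
    rintro ⟨f, hf⟩ h
    apply Subtype.ext
    change f = 0
    have h0 (m : ℕ) (hm : m ≤ 1) : fischer 2 (X 0 ^ m * X 1 ^ (n - m)) f = 0 :=
      congrFun h ⟨m, by omega⟩
    have hmon (α : Fin 2 →₀ ℕ) : ∃ p, normSqPoly 2 ∣ monomial α (coeff α f) - p ∧
        fischer 2 p f = 0 := by
      by_cases hα : coeff α f = 0
      · exact ⟨0, by simp [hα], by simp⟩
      have hdeg := (show f.IsHomogeneous n from hf.1).degree_eq_sum_deg_support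
        (mem_support_iff.2 hα)
      have hdeg' : n = α 0 + α 1 := by
        rw [hdeg, ← Fin.sum_univ_two (fun i => α i)]
        exact Finsupp.sum_fintype α (fun _ a => a) (fun _ => rfl)
      obtain ⟨c, m, hm, -, h⟩ := normSqPoly_two_dvd_monomial_sub (α 0) (α 1)
      rw [← hdeg'] at h
      refine ⟨(coeff α f * c) • (X 0 ^ m * X 1 ^ (n - m)), ?_, ?_⟩
      · have : monomial α (coeff α f) - (coeff α f * c) • (X 0 ^ m * X 1 ^ (n - m)) =
            C (coeff α f) * (X 0 ^ α 0 * X 1 ^ α 1 - C c * (X 0 ^ m * X 1 ^ (n - m))) := by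
          rw [monomial_eq, Finsupp.prod_fintype _ _ (by simp), Fin.prod_univ_two, smul_eq_C_mul,
            C_mul]
          ring
        rw [this]
        exact Dvd.dvd.mul_left h _
      · rw [map_smul, LinearMap.smul_apply, h0 m hm, smul_zero]
    choose p hp hp0 using hmon
    refine eq_zero_of_normSqPoly_dvd_sub hf (p := ∑ α ∈ f.support, p α) ?_ ?_
    · nth_rewrite 1 [f.as_sum]
      rw [← Finset.sum_sub_distrib]
      exact Finset.dvd_sum fun α _ => hp α
    · rw [map_sum, LinearMap.sum_apply]
      exact Finset.sum_eq_zero fun α _ => hp0 α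
  simpa using LinearMap.finrank_le_finrank_of_injective hL

/-- In the plane every point is reached from the first axis by the square of a rotation. -/
theorem exists_rotation_sq (x : Fin 2 → ℝ) (s : ℝ) (hs : s ^ 2 = ∑ i, x i ^ 2) :
    ∃ A ∈ Matrix.specialOrthogonalGroup (Fin 2) ℝ,
      (A * A).mulVec (s • Pi.single 0 1) = x := by
  rw [Fin.sum_univ_two] at hs
  by_cases hs0 : s = 0
  · subst hs0
    refine ⟨1, one_mem _, ?_⟩
    have h0 : x 0 = 0 := by nlinarith [sq_nonneg (x 0), sq_nonneg (x 1)]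
    have h1 : x 1 = 0 := by nlinarith [sq_nonneg (x 0), sq_nonneg (x 1)]
    ext i
    fin_cases i <;> simp [h0, h1]
  -- Halving the angle: `z` is a complex square root of the unit vector x/s, and the matrix is
  -- multiplication by `z`.
  obtain ⟨z, hz⟩ := IsAlgClosed.exists_pow_nat_eq (⟨x 0 / s, x 1 / s⟩ : ℂ) (n := 2) (by norm_num)
  have hre : z.re * z.re - z.im * z.im = x 0 / s := by
    simpa [pow_two] using congrArg Complex.re hz
  have him : z.re * z.im + z.im * z.re = x 1 / s := by
    simpa [pow_two] using congrArg Complex.im hz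
  have hn : z.re ^ 2 + z.im ^ 2 = 1 := by
    have h1 : (z.re ^ 2 + z.im ^ 2) ^ 2 = (x 0 / s) ^ 2 + (x 1 / s) ^ 2 := by
      rw [← hre, ← him]; ring
    have h2 : (x 0 / s) ^ 2 + (x 1 / s) ^ 2 = 1 := by
      rw [div_pow, div_pow, ← add_div, ← hs]
      field_simp
    rw [h2] at h1
    exact (pow_eq_one_iff_of_nonneg (by positivity) two_ne_zero).1 h1
  refine ⟨!![z.re, -z.im; z.im, z.re], ?_, ?_⟩
  · rw [Matrix.of_mem_specialOrthogonalGroup_fin_two_iff]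
    exact ⟨rfl, rfl, by rw [neg_sq, hn]⟩
  · have h0 : x 0 = s * (z.re * z.re - z.im * z.im) := by rw [hre]; field_simp
    have h1 : x 1 = s * (z.re * z.im + z.im * z.re) := by rw [him]; field_simp
    ext i
    fin_cases i
    · simp [Matrix.mulVec_smul, h0, sub_eq_add_neg]
    · simp [Matrix.mulVec_smul, h1, add_comm]

/-- Such an `f` is constant on circles: it is zero for odd n and a multiple of rⁿ for even n. Since
n ≠ 0, r² divides it. -/
theorem eq_zero_of_compMatrix_sq {f : MvPolynomial (Fin 2) ℝ} (hf : f ∈ harmonics 2 n)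
    (hn : n ≠ 0) (hinv : ∀ A ∈ Matrix.specialOrthogonalGroup (Fin 2) ℝ,
      compMatrix (A * A) f = f) : f = 0 := by
  set c := eval (Pi.single 0 1) f with hc
  have key (x : Fin 2 → ℝ) (s : ℝ) (hs : s ^ 2 = ∑ i, x i ^ 2) : eval x f = s ^ n * c := by
    obtain ⟨A, hA, hAx⟩ := exists_rotation_sq x s hs
    rw [hc, ← eval_smul_of_isHomogeneous hf.1, ← hAx, ← eval_compMatrix, hinv A hA]
  refine eq_zero_of_normSqPoly_dvd_sub hf (p := 0) ?_ (by simp)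
  rw [sub_zero]
  have hpoly : f = if Even n then C c * normSqPoly 2 ^ (n / 2) else 0 := by
    refine MvPolynomial.funext fun x => ?_
    have hs2 : Real.sqrt (∑ i, x i ^ 2) ^ 2 = ∑ i, x i ^ 2 :=
      Real.sq_sqrt (Finset.sum_nonneg fun i _ => sq_nonneg _)
    set s := Real.sqrt (∑ i, x i ^ 2) with hs
    have h1 := key x s hs2
    have h2 := key x (-s) (by rw [neg_sq, hs2])
    by_cases he : Even n
    · obtain ⟨m, hm⟩ := he
      rw [if_pos ⟨m, hm⟩, map_mul, eval_C, map_pow, eval_normSqPoly, ← hs2, h1,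
        show n / 2 = m by omega, ← pow_mul, show 2 * m = n by omega, mul_comm]
    · rw [(Nat.not_even_iff_odd.1 he).neg_pow] at h2
      rw [if_neg he, map_zero]
      linarith
  rw [hpoly]
  split_ifs with he
  · obtain ⟨m, hm⟩ := he
    exact Dvd.dvd.mul_left (dvd_pow_self _ (by omega)) _
  · exact dvd_zero _

/-- A proper nonzero `W` would be a line. Rotations act on it isometrically, hence by ±1, so their
squares act trivially. -/
theorem harmonics_le_of_two (hn : n ≠ 0) {W : Submodule ℝ (MvPolynomial (Fin 2) ℝ)}
    (hW : W ≤ harmonics 2 n) (hW0 : W ≠ ⊥)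
    (hinv : ∀ A ∈ Matrix.specialOrthogonalGroup (Fin 2) ℝ, ∀ f ∈ W, compMatrix A f ∈ W) :
    harmonics 2 n ≤ W := by
  by_contra hle
  have hlt : Module.finrank ℝ W < Module.finrank ℝ (harmonics 2 n) :=
    Submodule.finrank_lt_finrank_of_lt (lt_of_le_not_ge hW hle)
  have : FiniteDimensional ℝ W := Submodule.finiteDimensional_of_le hW
  have hpos : Module.finrank ℝ W ≠ 0 := fun h => hW0 (Submodule.finrank_eq_zero.1 h)
  have h1 : Module.finrank ℝ W = 1 := by
    have := finrank_harmonics_two_le (n := n)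
    omega
  obtain ⟨⟨f, hf⟩, hf0, hspan⟩ := finrank_eq_one_iff'.1 h1
  refine hf0 (Subtype.ext (eq_zero_of_compMatrix_sq (hW hf) hn fun A hA => ?_))
  obtain ⟨c, hc⟩ := hspan ⟨compMatrix A f, hinv A hA f hf⟩
  replace hc : c • f = compMatrix A f := congrArg Subtype.val hc
  have hff : fischer 2 f f ≠ 0 := fun h => hf0 (Subtype.ext (eq_zero_of_fischer_self h))
  have h2 : fischer 2 (compMatrix A f) (compMatrix A f) = fischer 2 f f := by
    rw [fischer_compMatrix, compMatrix_transpose_compMatrix hA]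
  have hc2 : c * c = 1 := by
    rw [← hc, LinearMap.map_smul₂, map_smul, smul_eq_mul, smul_eq_mul, ← mul_assoc] at h2
    exact mul_right_cancel₀ hff (by rw [h2, one_mul])
  rw [compMatrix_mul, ← hc, map_smul, ← hc, smul_smul, hc2, one_smul]

/-! ### Irreducibility in all dimensions, and existence of nonzero harmonics. -/

/-- Every nonzero space of harmonics that is stable under rotations contains all of them. -/
theorem harmonics_le_of_invariant (hd : 1 ≤ d) {W : Submodule ℝ (MvPolynomial (Fin d) ℝ)}
    (hW : W ≤ harmonics d n) (hW0 : W ≠ ⊥)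
    (hinv : ∀ A ∈ Matrix.specialOrthogonalGroup (Fin d) ℝ, ∀ f ∈ W, compMatrix A f ∈ W) :
    harmonics d n ≤ W := by
  rcases Nat.eq_zero_or_pos n with rfl | hn
  · exact harmonics_le_of_eval hW hW0 0 fun f hf => eq_zero_of_eval_eq_zero_of_degree_zero hf
  obtain rfl | rfl | hd3 : d = 1 ∨ d = 2 ∨ 3 ≤ d := by omega
  · exact harmonics_le_of_eval hW hW0 1 fun f hf => eq_zero_of_eval_eq_zero_of_dim_one hf
  · exact harmonics_le_of_two hn.ne' hW hW0 hinv
  · exact harmonics_le_of_three_le hd3 hW hW0 hinv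

theorem eq_bot_or_eq_top_of_invariant (hd : 1 ≤ d) (U : Submodule ℝ (harmonics d n))
    (hU : ∀ Q : Matrix.specialOrthogonalGroup (Fin d) ℝ, ∀ f ∈ U, harmonicRep d n Q f ∈ U) :
    U = ⊥ ∨ U = ⊤ := by
  rw [or_iff_not_imp_left]
  intro hU0
  have h := harmonics_le_of_invariant hd (W := U.map (harmonics d n).subtype)
    (Submodule.map_subtype_le _ _)
    (fun h => hU0 (Submodule.map_injective_of_injective (harmonics d n).injective_subtype
      (by rw [h, Submodule.map_bot])))
    (by
      rintro A hA _ ⟨f, hf, rfl⟩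
      -- The inverse cancels the one in the definition of `harmonicRep`.
      have h1 := hU (⟨A, hA⟩⁻¹) f hf
      refine ⟨_, h1, ?_⟩
      change compMatrix _ _ = _
      rw [inv_inv])
  rw [eq_top_iff]
  rintro ⟨f, hf⟩ -
  obtain ⟨g, hg, hgf⟩ := h hf
  rwa [show (⟨f, hf⟩ : harmonics d n) = g from Subtype.ext hgf.symm]

/-- The real and imaginary parts of `(x_i + √-1 x_j) ^ n`. -/
theorem exists_conjugate_pair {i j : Fin d} (hij : i ≠ j) (n : ℕ) :
    ∃ p q : MvPolynomial (Fin d) ℝ, p.IsHomogeneous n ∧ q.IsHomogeneous n ∧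
      pderiv i p = pderiv j q ∧ pderiv j p = -pderiv i q ∧
      (∀ l, l ≠ i → l ≠ j → pderiv l p = 0 ∧ pderiv l q = 0) ∧
      eval (Pi.single i 1) p = 1 ∧ eval (Pi.single i 1) q = 0 := by
  induction n with
  | zero => exact ⟨1, 0, isHomogeneous_one _ _, isHomogeneous_zero _ _ _, by simp, by simp,
      by simp, by simp, by simp⟩
  | succ n ih =>
    obtain ⟨p, q, hp, hq, h1, h2, h3, h4, h5⟩ := ih
    have hX (l : Fin d) {f : MvPolynomial (Fin d) ℝ} (hf : f.IsHomogeneous n) :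
        (X l * f).IsHomogeneous (n + 1) := by
      rw [add_comm]; exact (isHomogeneous_X ℝ l).mul hf
    refine ⟨X i * p - X j * q, X i * q + X j * p, (hX i hp).sub (hX j hq),
      (hX i hq).add (hX j hp), ?_, ?_, fun l hi hj => ?_, ?_, ?_⟩
    · simp only [map_sub, map_add, pderiv_mul, pderiv_X_self, pderiv_X_of_ne hij,
        pderiv_X_of_ne hij.symm, h1, h2]
      ring
    · simp only [map_sub, map_add, pderiv_mul, pderiv_X_self, pderiv_X_of_ne hij,
        pderiv_X_of_ne hij.symm, h1, h2]
      ring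
    · simp [pderiv_X_of_ne hi.symm, pderiv_X_of_ne hj.symm, h3 l hi hj]
    · simp [h4, h5, hij.symm]
    · simp [h4, h5, hij.symm]

theorem pderiv_pderiv_comm (i j : Fin d) (f : MvPolynomial (Fin d) ℝ) :
    pderiv i (pderiv j f) = pderiv j (pderiv i f) := by
  ext α
  simp only [coeff_pderiv, Finsupp.add_apply, Finsupp.single_apply]
  rw [add_right_comm]
  by_cases h : i = j
  · subst h; rfl
  · simp [h, Ne.symm h]; ring

/-- The Cauchy–Riemann equations make the real part of (x_i + √-1 x_j)ⁿ harmonic. -/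
theorem exists_harmonic_ne_zero (hd : 2 ≤ d) (n : ℕ) : ∃ f ∈ harmonics d n, f ≠ 0 := by
  have : Nontrivial (Fin d) := Fin.nontrivial_iff_two_le.2 hd
  obtain ⟨i, j, hij⟩ := exists_pair_ne (Fin d)
  obtain ⟨p, q, hp, -, h1, h2, h3, h4, -⟩ := exists_conjugate_pair hij n
  refine ⟨p, ⟨hp, ?_⟩, fun h => by simp [h] at h4⟩
  change laplacian d p = 0
  simp only [laplacian, LinearMap.sum_apply, LinearMap.comp_apply, Derivation.coeFn_coe]
  rw [Finset.sum_eq_add_of_mem i j (Finset.mem_univ _) (Finset.mem_univ _) hij, h1, h2,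
    pderiv_pderiv_comm i j]
  · simp
  · intro l _ hl
    simp [h3 l hl.1 hl.2]

theorem isIrreducible_harmonicRep (hd : 2 ≤ d) (n : ℕ) : (harmonicRep d n).IsIrreducible := by
  have : Nontrivial (Subrepresentation (harmonicRep d n)) := by
    refine ⟨⟨⊥, ⊤, fun h => ?_⟩⟩
    obtain ⟨f, hf, hf0⟩ := exists_harmonic_ne_zero hd n
    have h1 : (⟨f, hf⟩ : harmonics d n) ∈
        (⊤ : Subrepresentation (harmonicRep d n)).toSubmodule := Submodule.mem_top
    rw [← h] at h1
    exact hf0 (congrArg Subtype.val ((Submodule.mem_bot ℝ).1 h1))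
  refine ⟨fun U => ?_⟩
  refine (eq_bot_or_eq_top_of_invariant (by omega) U.toSubmodule
    fun Q f hf => U.apply_mem_toSubmodule Q hf).imp (fun h => ?_) (fun h => ?_)
  · exact SetLike.ext fun f => by
      change f ∈ U.toSubmodule ↔ f ∈ (⊥ : Submodule ℝ _)
      rw [h]
  · exact SetLike.ext fun f => by
      change f ∈ U.toSubmodule ↔ f ∈ (⊤ : Submodule ℝ _)
      rw [h]

/-! ### The Gegenbauer polynomial as a harmonic polynomial. -/

theorem pderiv_normSqPoly (i : Fin d) : pderiv i (normSqPoly d) = 2 * X i := by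
  classical
  simp only [normSqPoly, map_sum, pderiv_pow, pderiv_X]
  rw [Finset.sum_eq_single i]
  · simp
  · intro j _ hj
    simp [hj]
  · simp

theorem laplacian_mul (f g : MvPolynomial (Fin d) ℝ) :
    laplacian d (f * g) =
      laplacian d f * g + 2 * ∑ i, pderiv i f * pderiv i g + f * laplacian d g := by
  simp only [laplacian, LinearMap.sum_apply, LinearMap.comp_apply, Derivation.coeFn_coe,
    Finset.sum_mul, Finset.mul_sum, ← Finset.sum_add_distrib]
  refine Finset.sum_congr rfl fun i _ => ?_
  simp only [pderiv_mul, map_add]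
  ring

theorem laplacian_X_pow (k : Fin d) (m : ℕ) :
    laplacian d (X k ^ m) = C ((m : ℝ) * (m - 1)) * X k ^ (m - 2) := by
  classical
  simp only [laplacian, LinearMap.sum_apply, LinearMap.comp_apply, Derivation.coeFn_coe]
  rw [Finset.sum_eq_single k]
  · rcases m with _ | m
    · simp
    · simp only [pderiv_pow, pderiv_X_self, pderiv_mul, mul_one, Nat.add_sub_cancel]
      rw [show m + 1 - 2 = m - 1 by omega]
      simp
      ring
  · intro i _ hi
    simp [pderiv_X_of_ne hi.symm]
  · simp

theorem laplacian_normSqPoly_pow (j : ℕ) :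
    laplacian d (normSqPoly d ^ j) =
      C (2 * (j : ℝ) * (2 * j + d - 2)) * normSqPoly d ^ (j - 1) := by
  rcases j with _ | j
  · simp [laplacian]
  have h (i : Fin d) : pderiv i (pderiv i (normSqPoly d ^ (j + 1))) =
      C (4 * ((j : ℝ) + 1) * j) * normSqPoly d ^ (j - 1) * X i ^ 2 +
        C (2 * ((j : ℝ) + 1)) * normSqPoly d ^ j := by
    simp only [pderiv_pow, pderiv_mul, pderiv_normSqPoly, pderiv_X_self, Nat.add_sub_cancel]
    have h2 : pderiv i (2 : MvPolynomial (Fin d) ℝ) = 0 := Derivation.map_natCast _ 2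
    simp [h2, map_ofNat]
    ring
  simp only [laplacian, LinearMap.sum_apply, LinearMap.comp_apply, Derivation.coeFn_coe, h]
  rw [Finset.sum_add_distrib, ← Finset.mul_sum, ← normSqPoly]
  have h2 : C (4 * ((j : ℝ) + 1) * j) * normSqPoly d ^ (j - 1) * normSqPoly d =
      C (4 * ((j : ℝ) + 1) * j) * normSqPoly d ^ j := by
    rcases j with _ | j
    · simp
    · rw [Nat.add_sub_cancel, mul_assoc, ← pow_succ]
  rw [h2]
  simp only [Finset.sum_const, Finset.card_univ, Fintype.card_fin, Nat.add_sub_cancel,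
    nsmul_eq_mul, ← map_natCast (C : ℝ →+* MvPolynomial (Fin d) ℝ)]
  rw [← mul_assoc, ← C_mul, ← add_mul, ← C_add]
  congr 2
  push_cast
  ring

/-- The truncated exponents `m - 2` and `j - 1` do no harm: wherever truncation occurs, the
coefficient is zero. -/
theorem laplacian_X_pow_mul_normSqPoly_pow (k : Fin d) (m j : ℕ) :
    laplacian d (X k ^ m * normSqPoly d ^ j) =
      C ((m : ℝ) * (m - 1)) * (X k ^ (m - 2) * normSqPoly d ^ j) +
      C (2 * (j : ℝ) * (2 * m + 2 * j + d - 2)) * (X k ^ m * normSqPoly d ^ (j - 1)) := by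
  have h : ∑ i, pderiv i (X k ^ m) * pderiv i (normSqPoly d ^ j) =
      C (2 * (m : ℝ) * j) * (X k ^ m * normSqPoly d ^ (j - 1)) := by
    rw [Finset.sum_eq_single k]
    · rcases m with _ | m
      · simp
      · simp only [pderiv_pow, pderiv_X_self, pderiv_normSqPoly, Nat.add_sub_cancel, C_mul,
          map_natCast, map_ofNat]
        ring
    · intro i _ hi
      simp [pderiv_X_of_ne hi.symm]
    · simp
  rw [laplacian_mul, laplacian_X_pow, laplacian_normSqPoly_pow, h]
  simp only [C_mul, C_add, C_sub, map_natCast, map_ofNat]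
  ring

/-- The coefficient of `t ^ (n - 2 j)` in the Gegenbauer polynomial. -/
def gegenbauerCoeff (n : ℕ) (lam : ℝ) (j : ℕ) : ℝ :=
  (ascPochhammer ℝ n).eval lam * 2 ^ n / (n ! : ℝ) *
    ((ascPochhammer ℝ j).eval (-(n : ℝ) / 2) * (ascPochhammer ℝ j).eval ((1 - (n : ℝ)) / 2) /
      ((ascPochhammer ℝ j).eval (1 - (n : ℝ) - lam) * (j ! : ℝ)))

theorem ascPochhammer_eval_ne_zero {lam : ℝ} (hlam : 0 < lam) {j : ℕ} (hj : j ≤ n) :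
    (ascPochhammer ℝ j).eval (1 - (n : ℝ) - lam) ≠ 0 := by
  induction j with
  | zero => simp
  | succ j ih =>
    rw [ascPochhammer_succ_eval]
    refine mul_ne_zero (ih (by omega)) (ne_of_lt ?_)
    have : (j : ℝ) + 1 ≤ n := by exact_mod_cast hj
    linarith

/-- At lam = (d - 2)/2 and 2(j + 1) ≤ n, the left side is the coefficient of x_k^(n-2j-2) r^(2j) in
the Laplacian of `zonal`. -/
theorem gegenbauerCoeff_succ {lam : ℝ} (hlam : 0 < lam) {j : ℕ} (hj : j + 1 ≤ n) :
    gegenbauerCoeff n lam j * ((n - 2 * j) * (n - 2 * j - 1)) +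
      gegenbauerCoeff n lam (j + 1) * (4 * (j + 1) * (n - j - 1 + lam)) = 0 := by
  have h1 := ascPochhammer_eval_ne_zero hlam (show j ≤ n by omega)
  have h2 : (n : ℝ) - j - 1 + lam ≠ 0 := by
    have : (j : ℝ) + 1 ≤ n := by exact_mod_cast hj
    exact ne_of_gt (by linarith)
  have h3 : 1 - (n : ℝ) - lam + j ≠ 0 := fun h => h2 (by linarith)
  have h4 : (j ! : ℝ) ≠ 0 := by exact_mod_cast j.factorial_ne_zero
  have h5 : (n ! : ℝ) ≠ 0 := by exact_mod_cast n.factorial_ne_zero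
  have h6 : (j : ℝ) + 1 ≠ 0 := by positivity
  simp only [gegenbauerCoeff, ascPochhammer_succ_eval, Nat.factorial_succ, Nat.cast_mul,
    Nat.cast_add, Nat.cast_one]
  field_simp
  ring

/-- The homogeneous polynomial `‖x‖ⁿ Cₙ(x_k / ‖x‖)`. -/
def zonal (k : Fin d) (n : ℕ) (lam : ℝ) : MvPolynomial (Fin d) ℝ :=
  ∑ j ∈ Finset.range (n / 2 + 1),
    C (gegenbauerCoeff n lam j) * (X k ^ (n - 2 * j) * normSqPoly d ^ j)

theorem isHomogeneous_normSqPoly : (normSqPoly d).IsHomogeneous 2 :=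
  IsHomogeneous.sum _ _ _ fun i _ => isHomogeneous_X_pow i 2

theorem zonal_mem_harmonics (hd : 3 ≤ d) (k : Fin d) (n : ℕ) :
    zonal k n (((d : ℝ) - 2) / 2) ∈ harmonics d n := by
  set lam : ℝ := ((d : ℝ) - 2) / 2 with hlam
  have hlam0 : 0 < lam := by
    have : (3 : ℝ) ≤ d := by exact_mod_cast hd
    linarith
  refine ⟨IsHomogeneous.sum _ _ _ fun j hj => ?_, ?_⟩
  · have hj' := Finset.mem_range.1 hj
    have := ((isHomogeneous_X_pow (R := ℝ) k (n - 2 * j)).mul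
      ((isHomogeneous_normSqPoly (d := d)).pow j)).C_mul (gegenbauerCoeff n lam j)
    rwa [show n - 2 * j + 2 * j = n by omega] at this
  · change laplacian d (zonal k n lam) = 0
    have hterm (j : ℕ) : laplacian d (C (gegenbauerCoeff n lam j) *
        (X k ^ (n - 2 * j) * normSqPoly d ^ j)) =
        C (gegenbauerCoeff n lam j * (((n - 2 * j : ℕ) : ℝ) * (((n - 2 * j : ℕ) : ℝ) - 1))) *
          (X k ^ (n - 2 * j - 2) * normSqPoly d ^ j) +
        C (gegenbauerCoeff n lam j *
            (2 * (j : ℝ) * (2 * ((n - 2 * j : ℕ) : ℝ) + 2 * j + d - 2))) *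
          (X k ^ (n - 2 * j) * normSqPoly d ^ (j - 1)) := by
      rw [← smul_eq_C_mul, map_smul, laplacian_X_pow_mul_normSqPoly_pow, smul_eq_C_mul]
      simp only [C_mul]
      ring
    rw [zonal, map_sum, Finset.sum_congr rfl fun j _ => hterm j, Finset.sum_add_distrib,
      Finset.sum_range_succ, Finset.sum_range_succ']
    -- The top term of the first sum and the zeroth term of the second vanish; the remaining terms
    -- cancel in pairs after an index shift.
    have hlast : ((n - 2 * (n / 2) : ℕ) : ℝ) * (((n - 2 * (n / 2) : ℕ) : ℝ) - 1) = 0 := by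
      obtain h | h : n - 2 * (n / 2) = 0 ∨ n - 2 * (n / 2) = 1 := by omega
      · simp [h]
      · simp [h]
    rw [hlast]
    simp only [Nat.cast_zero, mul_zero, zero_mul, map_zero, add_zero]
    rw [← Finset.sum_add_distrib]
    refine Finset.sum_eq_zero fun j hj => ?_
    have hj' : 2 * (j + 1) ≤ n := by
      have := Finset.mem_range.1 hj
      omega
    rw [Nat.add_sub_cancel, show n - 2 * (j + 1) = n - 2 * j - 2 by omega, ← add_mul, ← C_add]
    have hcast : ((n - 2 * j : ℕ) : ℝ) = n - 2 * j := by
      rw [Nat.cast_sub (by omega)]; push_cast; ring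
    have hcast2 : ((n - 2 * j - 2 : ℕ) : ℝ) = n - 2 * j - 2 := by
      rw [Nat.cast_sub (by omega), hcast]; push_cast; ring
    have h := gegenbauerCoeff_succ (n := n) hlam0 (j := j) (by omega)
    rw [hcast, hcast2]
    have h' : gegenbauerCoeff n lam j * (((n : ℝ) - 2 * j) * (n - 2 * j - 1)) +
        gegenbauerCoeff n lam (j + 1) * (2 * ((j + 1 : ℕ) : ℝ) *
          (2 * ((n : ℝ) - 2 * j - 2) + 2 * ((j + 1 : ℕ) : ℝ) + d - 2)) = 0 := by
      rw [← h, hlam]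
      push_cast
      ring
    rw [h', C_0, zero_mul]

theorem eval_zonal (k : Fin d) (n : ℕ) (lam : ℝ) {x : EuclideanSpace ℝ (Fin d)} (hx : x ≠ 0) :
    eval (fun i => x i) (zonal k n lam) =
      ‖x‖ ^ n * (gegenbauer n lam).eval (x k / ‖x‖) := by
  have hx0 : ‖x‖ ≠ 0 := norm_ne_zero_iff.2 hx
  rw [zonal, gegenbauer, map_sum, Polynomial.eval_finsetSum, Finset.mul_sum]
  refine Finset.sum_congr rfl fun j hj => ?_
  have hj' : 2 * j ≤ n := by
    have := Finset.mem_range.1 hj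
    omega
  rw [Polynomial.eval_monomial, ← gegenbauerCoeff]
  simp only [map_mul, map_pow, eval_C, eval_X, eval_normSqPoly]
  rw [← EuclideanSpace.real_norm_sq_eq, ← pow_mul, div_pow]
  have : ‖x‖ ^ n = ‖x‖ ^ (2 * j) * ‖x‖ ^ (n - 2 * j) := by rw [← pow_add]; congr 1; omega
  rw [this]
  field_simp

theorem gegenbauer_ne_zero (n : ℕ) {lam : ℝ} (hlam : 0 < lam) : gegenbauer n lam ≠ 0 := by
  intro h
  have h1 := congrArg (fun p => Polynomial.coeff p n) h
  simp only [gegenbauer, Polynomial.finsetSum_coeff, Polynomial.coeff_zero,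
    Polynomial.coeff_monomial] at h1
  rw [Finset.sum_eq_single 0] at h1
  · have h2 := ascPochhammer_pos n lam hlam
    have h3 : (n ! : ℝ) ≠ 0 := by exact_mod_cast n.factorial_ne_zero
    simp [h2.ne', h3] at h1
  · intro j hj hj0
    have := Finset.mem_range.1 hj
    rw [if_neg (by omega)]
  · simp

/-- The Gegenbauer polynomial has finitely many roots, so some t in [0, 1] is not one; a unit vector
with k-th coordinate t is the test point. -/
theorem zonal_ne_zero (hd : 3 ≤ d) (k : Fin d) (n : ℕ) : zonal k n (((d : ℝ) - 2) / 2) ≠ 0 := by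
  classical
  set lam : ℝ := ((d : ℝ) - 2) / 2 with hlam
  have hlam0 : 0 < lam := by
    have : (3 : ℝ) ≤ d := by exact_mod_cast hd
    linarith
  obtain ⟨i, hik⟩ : ∃ i, i ≠ k := by
    have : Nontrivial (Fin d) := Fin.nontrivial_iff_two_le.2 (by omega)
    exact exists_ne k
  obtain ⟨t, ht, ht0⟩ := (Set.Icc_infinite (show (0 : ℝ) < 1 by norm_num)).exists_notMem_finset
    (gegenbauer n lam).roots.toFinset
  have hroot : (gegenbauer n lam).eval t ≠ 0 := fun h => ht0 (by
    rw [Multiset.mem_toFinset, Polynomial.mem_roots (gegenbauer_ne_zero n hlam0)]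
    exact h)
  set x : EuclideanSpace ℝ (Fin d) :=
    WithLp.toLp 2 (Real.sqrt (1 - t ^ 2) • Pi.single i 1 + t • Pi.single k 1) with hx
  have hxk : x k = t := by simp [hx, hik.symm]
  have hnorm : ‖x‖ = 1 := by
    have h1 : Real.sqrt (1 - t ^ 2) ^ 2 = 1 - t ^ 2 := Real.sq_sqrt (by nlinarith [ht.1, ht.2])
    have h2 : ‖x‖ ^ 2 = 1 := by
      rw [EuclideanSpace.real_norm_sq_eq, Finset.sum_eq_add_of_mem i k (Finset.mem_univ _)
        (Finset.mem_univ _) hik]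
      · simp [hx, hik, hik.symm, h1]
      · intro l _ hl
        simp [hx, hl.1, hl.2]
    exact (pow_eq_one_iff_of_nonneg (norm_nonneg x) two_ne_zero).1 h2
  intro h
  have h1 := eval_zonal k n lam (x := x) (norm_ne_zero_iff.1 (by rw [hnorm]; norm_num))
  rw [h, hnorm, hxk] at h1
  simp at h1
  exact hroot h1.symm

/-! ### Characterization of the invariant harmonics. -/

theorem dotProduct_mulVec_mulVec {A : Matrix (Fin d) (Fin d) ℝ}
    (hA : A ∈ Matrix.specialOrthogonalGroup (Fin d) ℝ) (x y : Fin d → ℝ) :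
    A.mulVec x ⬝ᵥ A.mulVec y = x ⬝ᵥ y := by
  rw [Matrix.dotProduct_mulVec, ← Matrix.mulVec_transpose, mulVec_transpose_eq hA rfl]

theorem compMatrix_zonal (k : Fin d) (n : ℕ) (lam : ℝ) {A : Matrix (Fin d) (Fin d) ℝ}
    (hA : A ∈ Matrix.specialOrthogonalGroup (Fin d) ℝ)
    (hk : A.mulVec (Pi.single k 1) = Pi.single k 1) :
    compMatrix A (zonal k n lam) = zonal k n lam := by
  refine MvPolynomial.funext fun x => ?_
  have h1 : A.mulVec x k = x k := by
    have := dotProduct_mulVec_mulVec hA (Pi.single k 1) x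
    rw [hk] at this
    simpa using this
  have h2 : ∑ i, A.mulVec x i ^ 2 = ∑ i, x i ^ 2 := by
    have := dotProduct_mulVec_mulVec hA x x
    simpa only [dotProduct, ← pow_two] using this
  simp [eval_compMatrix, zonal, eval_normSqPoly, h1, h2]

/-- The harmonics fixed by all rotations that fix `e_k` are the multiples of the zonal one. -/
theorem invariant_iff_exists_smul_zonal (hd : 3 ≤ d) (k : Fin d) (Y : harmonics d n) :
    (∀ Q : Matrix.specialOrthogonalGroup (Fin d) ℝ,
      (Q : Matrix (Fin d) (Fin d) ℝ).mulVec (Pi.single k 1) = Pi.single k 1 →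
        harmonicRep d n Q Y = Y) ↔
      ∃ c : ℝ, (Y : MvPolynomial (Fin d) ℝ) = c • zonal k n (((d : ℝ) - 2) / 2) := by
  set Z := zonal k n (((d : ℝ) - 2) / 2) with hZ
  have hZmem : Z ∈ harmonics d n := zonal_mem_harmonics hd k n
  have hZinv : ∀ A ∈ Matrix.specialOrthogonalGroup (Fin d) ℝ,
      A.mulVec (Pi.single k 1) = Pi.single k 1 → compMatrix A Z = Z :=
    fun A hA => compMatrix_zonal k n _ hA
  constructor
  · intro h
    have hYinv : ∀ A ∈ Matrix.specialOrthogonalGroup (Fin d) ℝ,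
        A.mulVec (Pi.single k 1) = Pi.single k 1 →
          compMatrix A (Y : MvPolynomial (Fin d) ℝ) = Y := by
      intro A hA hAk
      have h1 := congrArg Subtype.val (h (⟨A, hA⟩⁻¹) (mulVec_transpose_eq hA hAk))
      change compMatrix _ _ = _ at h1
      rwa [inv_inv] at h1
    -- An invariant harmonic vanishing at e_k is zero, so the Gegenbauer value at 1 need not be
    -- computed.
    have hZe : eval (Pi.single k 1) Z ≠ 0 := fun h0 =>
      zonal_ne_zero hd k n (eq_zero_of_invariant_of_eval_eq_zero hd k hZmem hZinv h0)
    refine ⟨eval (Pi.single k 1) (Y : MvPolynomial (Fin d) ℝ) / eval (Pi.single k 1) Z,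
      sub_eq_zero.1 (eq_zero_of_invariant_of_eval_eq_zero hd k
        (Submodule.sub_mem _ Y.2 (Submodule.smul_mem _ _ hZmem)) (fun A hA hAk => ?_) ?_)⟩
    · rw [map_sub, map_smul, hYinv A hA hAk, hZinv A hA hAk]
    · rw [map_sub, smul_eval]
      field_simp
      ring
  · rintro ⟨c, hc⟩ Q hQ
    apply Subtype.ext
    change compMatrix _ (Y : MvPolynomial (Fin d) ℝ) = _
    rw [hc, map_smul, hZinv _ (Q⁻¹).2 (mulVec_transpose_eq Q.2 hQ)]

theorem eq_smul_zonal_iff (k : Fin d) (lam c : ℝ) {Y : MvPolynomial (Fin d) ℝ} :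
    Y = c • zonal k n lam ↔ ∀ x : EuclideanSpace ℝ (Fin d), x ≠ 0 →
      eval (fun i => x i) Y = c * ‖x‖ ^ n * (gegenbauer n lam).eval (x k / ‖x‖) := by
  constructor
  · rintro rfl x hx
    rw [smul_eval, eval_zonal k n lam hx, mul_assoc]
  · intro h
    -- The formula is known only for x ≠ 0; the factor x_k covers the origin and is cancelled
    -- afterwards.
    have hk : X k * (Y - c • zonal k n lam) = 0 := by
      refine MvPolynomial.funext fun x => ?_
      by_cases hx : x = 0
      · simp [hx]
      · have hx' : WithLp.toLp 2 x ≠ 0 := fun h0 => hx (by simpa using h0)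
        have h1 := h _ hx'
        rw [mul_assoc, ← eval_zonal k n lam hx'] at h1
        change eval x Y = c * eval x _ at h1
        rw [map_mul, map_sub, smul_eval, h1, sub_self, mul_zero, map_zero]
    exact sub_eq_zero.1 ((mul_eq_zero.1 hk).resolve_left (X_ne_zero k))

end SphericalHarmonics

end

open SphericalHarmonics in
theorem mainTheorem7 :
    -- the representation on the harmonics has only the trivial invariant subspaces
    (∀ d n : ℕ, 1 ≤ d → ∀ U : Submodule ℝ (harmonics d n),
      (∀ Q : Matrix.specialOrthogonalGroup (Fin d) ℝ, ∀ f ∈ U, harmonicRep d n Q f ∈ U) →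
        U = ⊥ ∨ U = ⊤) ∧
    -- for `d ≥ 2` the space is moreover nonzero, so the representation is irreducible
    (∀ d n : ℕ, 2 ≤ d → (harmonicRep d n).IsIrreducible) ∧
    -- the harmonics that are invariant under all rotations fixing the last basis vector
    (∀ (d n : ℕ) (hd : 3 ≤ d),
      (∃ Z : harmonics d n, ∀ x : EuclideanSpace ℝ (Fin d), x ≠ 0 →
        MvPolynomial.eval (fun i => x i) (Z : MvPolynomial (Fin d) ℝ) =
          ‖x‖ ^ n * (gegenbauer n (((d : ℝ) - 2) / 2)).eval (x ⟨d - 1, by omega⟩ / ‖x‖)) ∧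
      (∀ Y : harmonics d n,
        (∀ Q : Matrix.specialOrthogonalGroup (Fin d) ℝ,
          (Q : Matrix (Fin d) (Fin d) ℝ).mulVec (Pi.single ⟨d - 1, by omega⟩ 1) =
              Pi.single ⟨d - 1, by omega⟩ 1 →
            harmonicRep d n Q Y = Y) ↔
        ∃ c : ℝ, ∀ x : EuclideanSpace ℝ (Fin d), x ≠ 0 →
          MvPolynomial.eval (fun i => x i) (Y : MvPolynomial (Fin d) ℝ) =
            c * ‖x‖ ^ n *
              (gegenbauer n (((d : ℝ) - 2) / 2)).eval (x ⟨d - 1, by omega⟩ / ‖x‖))) := by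
  refine ⟨fun d n hd U hU => eq_bot_or_eq_top_of_invariant hd U hU,
    fun d n hd => isIrreducible_harmonicRep hd n, fun d n hd => ⟨⟨⟨_, zonal_mem_harmonics hd _ n⟩,
      fun x hx => eval_zonal _ n _ hx⟩, fun Y => ?_⟩⟩
  rw [invariant_iff_exists_smul_zonal hd]
  exact exists_congr fun c => eq_smul_zonal_iff _ _ c
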